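/- All graphs are finite and simple. Two distinct letters $x,y$ alternate in a word $w$ if deleting all other letters from $w$ leaves a word of the form $xyxy\cdots$ or $yxyx\cdots$ (of even or odd length). A graph $G=(V,E)$ is word-representable if there is a word $w$ over the alphabet $V$, containing each letter of $V$ at least once, such that distinct $x,y\in V$ alternate in $w$ if and only if $xy\in E$. A graph is minimal non-word-representable if it is not word-representable but all its proper induced subgraphs are. For $n\ge 1$, a $K_4$-$K_n$ graph is a graph whose vertex set is the disjoint union of a clique $K_4$ of size $4$ and a clique $K_n$ of size $n$ such that no vertex of $K_n$ is adjacent to all four vertices of $K_4$. Let $B_1,\dots,B_7$ be the following graphs. Each consists of a clique on $\{1,2,3,4\}$, a clique on $\{5,\dots,4+k\}$, and edges between the two cliques given by the neighbourhoods $N(5),\dots,N(4+k)$ in $\{1,2,3,4\}$ of the vertices $5,\dots,4+k$, in this order: - $B_1$ ($k=3$): $\{1,2\},\{1,3\},\{2,3\}$; - $B_2$ ($k=3$): $\{1,2\},\{1,3\},\{1,4\}$; - $B_3$ ($k=4$): $\emptyset,\{1\},\{1,2,3\},\{1,2,4\}$; - $B_4$ ($k=4$): $\{1,2\},\{1\},\{1,3\},\{1,2,3\}$;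 - $B_5$ ($k=4$): $\{1,2\},\{1\},\{1,2,3\},\{1,2,4\}$; - $B_6$ ($k=4$): $\{1,2,3\},\{1,2,4\},\{2\},\{3\}$; - $B_7$ ($k=5$): $\emptyset,\{1,2\},\{1,3\},\{2,4\},\{3,4\}$. **Theorem.** For every $n\ge1$, a $K_4$-$K_n$ graph is word-representable if and only if it contains none of $B_1,\dots,B_7$ as an induced subgraph. Moreover, $B_1,\dots,B_7$ are pairwise non-isomorphic, each of them is a minimal non-word-representable graph and a $K_4$-$K_n$ graph for some $n\ge 1$, and every $K_4$-$K_n$ graph (for any $n\ge1$) that is minimal non-word-representable is isomorphic to one of them. -/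

import Mathlib

universe u

namespace TwoCliques

/-- The letters `x` and `y` alternate in the word `w`: after deleting all other letters, no two
consecutive letters are equal, i.e. what remains is `xyxy⋯` or `yxyx⋯`. -/
def Alternate {V : Type u} (x y : V) (w : List V) : Prop :=
  open scoped Classical in
  (w.filter (fun z => z = x ∨ z = y)).IsChain (· ≠ ·)

/-- `G` is word-representable: some word over the alphabet `V`, in which every letter occurs, has
the property that distinct letters `x`, `y` alternate in it iff `xy` is an edge. -/
def WordRepresentable {V : Type u} (G : SimpleGraph V) : Prop :=
  ∃ w : List V, (∀ v, v ∈ w) ∧ ∀ x y, x ≠ y → (Alternate x y w ↔ G.Adj x y)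

/-- `G` is a minimal non-word-representable graph: it is not word-representable, and all its
proper induced subgraphs are. -/
def MinimalNonWordRepresentable {V : Type u} (G : SimpleGraph V) : Prop :=
  ¬ WordRepresentable G ∧ ∀ s : Set V, s ≠ Set.univ → WordRepresentable (G.induce s)

/-- `G` is a `K_m`-`K_n` graph: its vertices split into a clique `A` of size `m` and a clique `B`
of size `n`, where no vertex of `B` is adjacent to every vertex of `A`. -/
def IsKK {V : Type u} (m n : ℕ) (G : SimpleGraph V) : Prop :=
  ∃ A B : Finset V, Disjoint A B ∧ (∀ v, v ∈ A ∨ v ∈ B) ∧ G.IsNClique m A ∧ G.IsNClique n B ∧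
    ∀ v ∈ B, ∃ a ∈ A, ¬ G.Adj v a

/-- The graph formed by a clique `K₄`, whose vertices are labelled `1, 2, 3, 4` (the vertex
`Sum.inl i` has label `i + 1`), and a disjoint clique with one vertex for each member of the list
`N`, that vertex being adjacent exactly to the vertices of `K₄` with label in that member. -/
def twoCliqueGraph (N : List (Finset ℕ)) : SimpleGraph (Fin 4 ⊕ Fin N.length) where
  Adj
    | Sum.inl i, Sum.inl j => i ≠ j
    | Sum.inl i, Sum.inr k => (i : ℕ) + 1 ∈ N.get k
    | Sum.inr k, Sum.inl i => (i : ℕ) + 1 ∈ N.get k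
    | Sum.inr k, Sum.inr l => k ≠ l
  symm := ⟨by
    rintro (i | k) (j | l) h
    exacts [Ne.symm h, h, h, Ne.symm h]⟩
  loopless := ⟨by rintro (i | k) h <;> exact h rfl⟩

/-- For each of the seven graphs `B₁, …, B₇`: the neighbourhoods in the clique `{1, 2, 3, 4}` of
the vertices `5, 6, …` of the other clique, in this order. -/
def forbiddenNbhds : Fin 7 → List (Finset ℕ) :=
  ![[{1, 2}, {1, 3}, {2, 3}],
    [{1, 2}, {1, 3}, {1, 4}],
    [∅, {1}, {1, 2, 3}, {1, 2, 4}],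
    [{1, 2}, {1}, {1, 3}, {1, 2, 3}],
    [{1, 2}, {1}, {1, 2, 3}, {1, 2, 4}],
    [{1, 2, 3}, {1, 2, 4}, {2}, {3}],
    [∅, {1, 2}, {1, 3}, {2, 4}, {3, 4}]]

/-- The graphs `B₁, …, B₇` (`B i` is `B_{i+1}`). -/
def B (i : Fin 7) : SimpleGraph (Fin 4 ⊕ Fin (forbiddenNbhds i).length) :=
  twoCliqueGraph (forbiddenNbhds i)

end TwoCliques

namespace TwoCliques

/-! Non-representability: order the letters of a representing word by first occurrence. An edge from
an earlier to a later letter says that in every prefix the two counts differ by 0 or 1 in favour of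
the earlier one. If `a < b < c < d` in this order and `ab`, `bc`, `cd`, `ad` are edges, the counts
decrease along the path by at most 1 in all, so `ac` and `bd` are edges too
(`WordRepresentable.exists_order`). A finite search shows that no order of the vertices of a `B i`
has this property.

Representability: vertices of the second clique with equal neighbourhoods in the `K₄` are adjacent
twins, and a twin class may replace one letter of a word (`wordRepresentable_of_map`). Only the set
of occurring neighbourhoods matters, a subset of the 15 proper subsets of the `K₄`. Up to
relabelling the `K₄`, each such set either contains one of 18 families forcing an induced `B i`, or
lies in one of 9 families represented by an explicit word (`exists_family`). This gives
`IsKK.wordRepresentable_or`, from which the characterization and the completeness of the list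
follow. -/

/-! ### Alternation through prefix counts -/

open scoped Classical in
theorem isChain_cons_filter_iff {V : Type u} {x y : V} (hxy : x ≠ y) (w : List V) :
    (y :: w.filter (fun z => z = x ∨ z = y)).IsChain (· ≠ ·) ↔
      ∀ u, u <+: w → u.count y ≤ u.count x ∧ u.count x ≤ u.count y + 1 := by
  -- The prepended `y` stands for the last letter read, so the next relevant letter must be `x`.
  -- Reading `x` exchanges the roles of the two letters.
  induction w generalizing x y with
  | nil => simp
  | cons z w ih =>
    have key : (∀ u, u <+: z :: w → u.count y ≤ u.count x ∧ u.count x ≤ u.count y + 1) ↔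
        ∀ u, u <+: w → (z :: u).count y ≤ (z :: u).count x ∧
          (z :: u).count x ≤ (z :: u).count y + 1 := by
      constructor
      · intro h u hu
        exact h _ ((List.prefix_cons_inj z).2 hu)
      · intro h u hu
        rcases List.prefix_cons_iff.1 hu with rfl | ⟨t, rfl, ht⟩
        · simp
        · exact h t ht
    rw [key]
    by_cases hx : z = x
    · subst hx
      have hf : (w.filter (fun v => v = z ∨ v = y)) = w.filter (fun v => v = y ∨ v = z) := by
        simp only [or_comm]
      have := ih (x := y) (y := z) hxy.symm
      rw [List.filter_cons_of_pos (by simp), List.isChain_cons_cons, hf, this]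
      simp only [List.count_cons_self, List.count_cons_of_ne hxy]
      constructor
      · rintro ⟨-, h⟩ u hu
        have := h u hu
        omega
      · intro h
        refine ⟨hxy.symm, fun u hu => ?_⟩
        have := h u hu
        omega
    · by_cases hy : z = y
      · subst hy
        rw [List.filter_cons_of_pos (by simp), List.isChain_cons_cons]
        refine ⟨fun h => absurd rfl h.1, fun h => ?_⟩
        have := (h [] List.nil_prefix).1
        simp [hx] at this
      · rw [List.filter_cons_of_neg (by simp [hx, hy]), ih hxy]
        simp only [List.count_cons_of_ne hx, List.count_cons_of_ne hy]

open scoped Classical in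
/-- A word in which `x` and `y` alternate, with `x` occurring first, has in each prefix as many
letters `x` as letters `y`, or one more. -/
theorem Alternate.count_le {V : Type u} {x y : V} (hxy : x ≠ y) {w : List V}
    (h : Alternate x y w) (hx : x ∈ w) (hlt : w.idxOf x < w.idxOf y) (u : List V)
    (hu : u <+: w) : u.count y ≤ u.count x ∧ u.count x ≤ u.count y + 1 := by
  refine (isChain_cons_filter_iff hxy w).1 ?_ u hu
  by_contra hc
  unfold Alternate at h
  -- If the restricted word began with `y`, no prefix would contain more letters `x` than `y`; the
  -- prefix ending at the first `x` does.
  have h' : (x :: w.filter (fun z => z = y ∨ z = x)).IsChain (· ≠ ·) := by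
    simp only [or_comm (a := _ = y)]
    cases hw : w.filter (fun z => z = x ∨ z = y) with
    | nil => simp
    | cons b t =>
      rw [hw] at h hc
      rw [List.isChain_cons_cons] at hc ⊢
      refine ⟨?_, h⟩
      rintro rfl
      exact hc ⟨hxy.symm, h⟩
  have hp := ((isChain_cons_filter_iff hxy.symm w).1 h' _
    (List.take_prefix (w.idxOf x + 1) w)).1
  have h1 : x ∈ w.take (w.idxOf x + 1) := by
    rw [List.mem_take_iff_idxOf_lt hx]; omega
  have h2 : y ∉ w.take (w.idxOf x + 1) := by
    intro hy
    have := (List.mem_take_iff_idxOf_lt (List.mem_of_mem_take hy)).1 hy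
    omega
  rw [List.count_eq_zero_of_not_mem h2] at hp
  have := List.count_pos_iff.2 h1
  omega

open scoped Classical in
theorem alternate_of_count_le {V : Type u} {x y : V} (hxy : x ≠ y) {w : List V}
    (h : ∀ u, u <+: w → u.count y ≤ u.count x ∧ u.count x ≤ u.count y + 1) :
    Alternate x y w :=
  ((isChain_cons_filter_iff hxy w).2 h).tail

/-- A word-representable graph has a linear order of its vertices without shortcuts of
length three. -/
theorem WordRepresentable.exists_order {V : Type u} {G : SimpleGraph V}
    (h : WordRepresentable G) : ∃ p : V → ℕ, p.Injective ∧ ∀ a b c d, p a < p b → p b < p c →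
      p c < p d → G.Adj a b → G.Adj b c → G.Adj c d → G.Adj a d → G.Adj a c ∧ G.Adj b d := by
  classical
  obtain ⟨w, hw, h⟩ := h
  refine ⟨fun v => w.idxOf v, fun x y hxy => (List.idxOf_inj (hw x)).1 hxy, ?_⟩
  intro a b c d hab hbc hcd eab ebc ecd ead
  have cnt : ∀ x y, w.idxOf x < w.idxOf y → G.Adj x y → ∀ u, u <+: w →
      u.count y ≤ u.count x ∧ u.count x ≤ u.count y + 1 := fun x y hlt hadj =>
    Alternate.count_le hadj.ne ((h x y hadj.ne).2 hadj) (hw x) hlt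
  have hac : a ≠ c := by rintro rfl; simp only at *; omega
  have hbd : b ≠ d := by rintro rfl; simp only at *; omega
  constructor
  -- The first three bounds give `a ≥ b ≥ c ≥ d` for the counts, and the edge `ad` gives `a ≤ d +
  -- 1`.
  · refine (h a c hac).1 (alternate_of_count_le hac fun u hu => ?_)
    have := cnt a b hab eab u hu
    have := cnt b c hbc ebc u hu
    have := cnt c d hcd ecd u hu
    have := cnt a d (by simp only at *; omega) ead u hu
    omega
  · refine (h b d hbd).1 (alternate_of_count_le hbd fun u hu => ?_)
    have := cnt a b hab eab u hu
    have := cnt b c hbc ebc u hu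
    have := cnt c d hcd ecd u hu
    have := cnt a d (by simp only at *; omega) ead u hu
    omega

/-! ### Substituting cliques for letters -/

theorem alternate_iff {V : Type u} [DecidableEq V] (x y : V) (w : List V) :
    Alternate x y w ↔ (w.filter (fun z => z = x ∨ z = y)).IsChain (· ≠ ·) := by
  unfold Alternate
  rw [List.filter_congr]
  intro z _
  simp

/-- Replacing the letters of a word by the vertices of disjoint cliques represents the graph
obtained by substituting these cliques. -/
theorem wordRepresentable_of_map {V : Type u} {W : Type*} [Finite V] {G : SimpleGraph V}
    (w : List W) (φ : V → W) (hφ : ∀ v, φ v ∈ w)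
    (h_same : ∀ x y, x ≠ y → φ x = φ y → G.Adj x y)
    (h_ne : ∀ x y, φ x ≠ φ y → (G.Adj x y ↔ Alternate (φ x) (φ y) w)) :
    WordRepresentable G := by
  classical
  have := Fintype.ofFinite V
  -- Each letter becomes its fibre, always listed in the same order; letters with empty fibre
  -- disappear, so `φ` need not be surjective.
  let L : W → List V := fun b => (Finset.univ.filter (fun v => φ v = b)).toList
  have hL : ∀ b v, v ∈ L b ↔ φ v = b := fun b v => by simp [L]
  have hLn : ∀ b, (L b).Nodup := fun b => Finset.nodup_toList _
  refine ⟨w.flatMap L, fun v => List.mem_flatMap.2 ⟨φ v, hφ v, (hL _ _).2 rfl⟩, ?_⟩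
  intro x y hxy
  by_cases hb : φ x = φ y
  · refine iff_of_true ?_ (h_same x y hxy hb)
    rw [alternate_iff, List.filter_flatMap]
    have hK : ∃ s t, s ≠ t ∧ ∀ b, (L b).filter (fun z => z = x ∨ z = y) =
        if b = φ x then [s, t] else [] := by
      have hperm : ((L (φ x)).filter (fun z => z = x ∨ z = y)).Perm [x, y] := by
        rw [List.perm_ext_iff_of_nodup ((hLn _).filter _) (by simp [hxy])]
        intro v
        simp only [List.mem_filter, hL, decide_eq_true_eq, List.mem_cons, List.not_mem_nil,
          or_false, and_iff_right_iff_imp]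
        rintro (rfl | rfl)
        exacts [rfl, hb.symm]
      have hnil : ∀ b, b ≠ φ x → (L b).filter (fun z => z = x ∨ z = y) = [] := by
        intro b hbx
        rw [List.filter_eq_nil_iff]
        intro v hv hv'
        rw [hL] at hv
        rcases of_decide_eq_true hv' with rfl | rfl
        · exact hbx hv.symm
        · exact hbx (hv.symm.trans hb.symm)
      obtain ⟨s, t, hst⟩ := List.length_eq_two.1 hperm.length_eq
      refine ⟨s, t, ?_, fun b => ?_⟩
      · have := (hLn (φ x)).filter (fun z => z = x ∨ z = y)
        rw [hst] at this
        simpa using this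
      · split_ifs with hbx
        · rw [hbx, hst]
        · exact hnil b hbx
    obtain ⟨s, t, hst, hK⟩ := hK
    simp only [hK]
    -- The restricted word is `stst⋯`; the leading `t` makes the induction go through.
    have : ∀ l : List W, (t :: l.flatMap fun b => if b = φ x then [s, t] else []).IsChain
        (· ≠ ·) := by
      intro l
      induction l with
      | nil => simp
      | cons b l ih =>
        rw [List.flatMap_cons]
        split_ifs with hbx
        · simpa [hst, hst.symm] using ih
        · exact ih
    exact (this w).tail
  · rw [h_ne x y hb, alternate_iff, alternate_iff, List.filter_flatMap]
    have hK : ∀ b, (L b).filter (fun z => z = x ∨ z = y) =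
        if b = φ x then [x] else if b = φ y then [y] else [] := by
      intro b
      have hp : ((L b).filter (fun z => z = x ∨ z = y)).Perm
          (if b = φ x then [x] else if b = φ y then [y] else []) := by
        rw [List.perm_ext_iff_of_nodup ((hLn _).filter _) (by split_ifs <;> simp)]
        intro v
        simp only [List.mem_filter, hL, decide_eq_true_eq]
        split_ifs with h1 h2 <;> grind
      split_ifs at hp ⊢ <;> simpa using hp
    have hmap : ∀ l : List W, (l.flatMap fun b => (L b).filter (fun z => z = x ∨ z = y)) =
        (l.filter (fun b => b = φ x ∨ b = φ y)).map (fun b => if b = φ x then x else y) := by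
      intro l
      simp only [hK]
      induction l with
      | nil => rfl
      | cons b l ih =>
        rw [List.flatMap_cons, ih]
        by_cases h1 : b = φ x
        · simp [h1]
        · by_cases h2 : b = φ y
          · simp [h2, Ne.symm hb]
          · simp [h1, h2]
    have hmem : ∀ b ∈ w.filter (fun b => b = φ x ∨ b = φ y), b = φ x ∨ b = φ y := by simp
    rw [hmap, List.isChain_map]
    generalize w.filter (fun b => b = φ x ∨ b = φ y) = l at hmem
    induction l with
    | nil => simp
    | cons b l ih =>
      cases l with
      | nil => simp
      | cons c l =>
        rw [List.isChain_cons_cons, List.isChain_cons_cons]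
        refine and_congr ?_ (ih fun d hd => hmem d (List.mem_cons_of_mem _ hd))
        rcases hmem b (by simp) with rfl | rfl <;> rcases hmem c (by simp) with rfl | rfl <;>
          simp [hb, Ne.symm hb, hxy, hxy.symm]

/-- Word-representability passes to induced subgraphs. -/
theorem WordRepresentable.of_isIndContained {V : Type u} {W : Type*} [Finite V]
    {G : SimpleGraph V} {H : SimpleGraph W} (hH : WordRepresentable H)
    (h : G.IsIndContained H) : WordRepresentable G := by
  obtain ⟨f⟩ := h
  obtain ⟨w, hw, hw'⟩ := hH
  exact wordRepresentable_of_map w f (fun v => hw _)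
    (fun x y hxy he => absurd (f.injective he) hxy)
    (fun x y hxy => by rw [hw' _ _ hxy, f.map_adj_iff])

/-! ### Numerical codes for vertices -/

/-- The universal two-clique graph on `ℕ`: the numbers `0, 1, 2, 3` form a clique, and `4 + t` is a
vertex of the other clique whose neighbours in the first one are the binary digits of `t`. -/
def codeAdj (c d : ℕ) : Bool :=
  if c < 4 then (if d < 4 then c != d else (d - 4).testBit c)
  else if d < 4 then (c - 4).testBit d else c != d

/-- The vertex with index `i` in the list of codes `l`. -/
def place {m : ℕ} (l : List ℕ) : Fin 4 ⊕ Fin m → ℕ :=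
  Sum.elim (fun i => l.getD i 0) (fun k => l.getD (4 + k) 0)

instance (N : List (Finset ℕ)) : DecidableRel (twoCliqueGraph N).Adj
  | Sum.inl i, Sum.inl j => inferInstanceAs (Decidable (i ≠ j))
  | Sum.inl i, Sum.inr k => inferInstanceAs (Decidable ((i : ℕ) + 1 ∈ N.get k))
  | Sum.inr k, Sum.inl i => inferInstanceAs (Decidable ((i : ℕ) + 1 ∈ N.get k))
  | Sum.inr k, Sum.inr l => inferInstanceAs (Decidable (k ≠ l))

instance (i : Fin 7) : DecidableRel (B i).Adj :=
  inferInstanceAs (DecidableRel (twoCliqueGraph (forbiddenNbhds i)).Adj)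

def vertexCodes : Fin 7 → List ℕ :=
  ![[0, 1, 2, 3, 7, 9, 10], [0, 1, 2, 3, 7, 9, 13], [0, 1, 2, 3, 4, 5, 11, 15],
    [0, 1, 2, 3, 7, 5, 9, 11], [0, 1, 2, 3, 7, 5, 11, 15], [0, 1, 2, 3, 11, 15, 6, 8],
    [0, 1, 2, 3, 4, 7, 9, 14, 16]]

/-- The code of a vertex of `B i`. -/
def code (i : Fin 7) (x : Fin 4 ⊕ Fin (forbiddenNbhds i).length) : ℕ := place (vertexCodes i) x

theorem code_injective (i : Fin 7) : (code i).Injective := by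
  have : ∀ i : Fin 7, ∀ x y, code i x = code i y → x = y := by decide +kernel
  exact this i

theorem codeAdj_code (i : Fin 7) (x y) : codeAdj (code i x) (code i y) = true ↔ (B i).Adj x y := by
  have : ∀ i : Fin 7, ∀ x y, codeAdj (code i x) (code i y) = true ↔ (B i).Adj x y := by
    decide +kernel
  exact this i x y

/-! ### Non-word-representability -/

section Search

/-- Whether some `d ∈ l` completes `a, b, c` to a shortcut. -/
def closesShortcut (a b c : ℕ) (l : List ℕ) : Bool :=
  l.any fun d => codeAdj c d && codeAdj a d && !(codeAdj a c && codeAdj b d)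

/-- Whether the pair `a, b` continues to a shortcut in `l`. -/
def pairShortcut (a b : ℕ) : List ℕ → Bool
  | [] => false
  | c :: l => codeAdj b c && closesShortcut a b c l || pairShortcut a b l

/-- Whether a shortcut starts at `a` and continues in `l`. -/
def startsShortcut (a : ℕ) : List ℕ → Bool
  | [] => false
  | b :: l => codeAdj a b && pairShortcut a b l || startsShortcut a l

/-- Whether a list of codes, as a linear order, has a shortcut of length three. -/
def hasShortcut : List ℕ → Bool
  | [] => false
  | a :: l => startsShortcut a l || hasShortcut l

/-- The lists obtained by inserting `v` at some place. -/
def insertions (v : ℕ) : List ℕ → List (List ℕ)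
  | [] => [[v]]
  | a :: l => (v :: a :: l) :: (insertions v l).map (a :: ·)

/-- Whether all ways of inserting the second list into the first create a shortcut. -/
def allShortcut : List ℕ → List ℕ → Bool
  | l, [] => hasShortcut l
  | l, v :: vs => hasShortcut l || (insertions v l).all fun l' => allShortcut l' vs

variable {p : ℕ → ℕ} {S : Set ℕ}

theorem not_hasShortcut
    (hp : ∀ a ∈ S, ∀ b ∈ S, ∀ c ∈ S, ∀ d ∈ S, p a < p b → p b < p c → p c < p d → codeAdj a b →
      codeAdj b c → codeAdj c d → codeAdj a d → codeAdj a c ∧ codeAdj b d)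
    (l : List ℕ) (hS : ∀ a ∈ l, a ∈ S) (hl : l.Pairwise (p · < p ·)) : hasShortcut l = false := by
  induction l with
  | nil => rfl
  | cons a l ih =>
    rw [List.pairwise_cons] at hl
    simp only [hasShortcut, Bool.or_eq_false_iff]
    refine ⟨?_, ih (fun b hb => hS b (List.mem_cons_of_mem _ hb)) hl.2⟩
    have ha := hS a List.mem_cons_self
    replace hS := fun b hb => hS b (List.mem_cons_of_mem _ hb)
    obtain ⟨hal, hl⟩ := hl
    clear ih
    induction l with
    | nil => rfl
    | cons b l ih =>
      simp only [List.pairwise_cons, List.mem_cons, forall_eq_or_imp] at hl hS hal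
      simp only [startsShortcut, Bool.or_eq_false_iff, Bool.and_eq_false_imp]
      refine ⟨fun hab => ?_, ih hS.2 hal.2 hl.2⟩
      obtain ⟨hb, hS⟩ := hS
      obtain ⟨hbl, hl⟩ := hl
      obtain ⟨hpab, -⟩ := hal
      clear ih
      induction l with
      | nil => rfl
      | cons c l ih =>
        simp only [List.pairwise_cons, List.mem_cons, forall_eq_or_imp] at hl hS hbl
        simp only [pairShortcut, Bool.or_eq_false_iff, Bool.and_eq_false_imp]
        refine ⟨fun hbc => ?_, ih hS.2 hbl.2 hl.2⟩
        simp only [closesShortcut, List.any_eq_false]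
        intro d hd h
        have := hp a ha b hb c hS.1 d (hS.2 d hd) hpab hbl.1 (hl.1 d hd) hab hbc
        simp_all

theorem exists_insertion (v : ℕ) (l : List ℕ) (hl : l.Pairwise (p · < p ·))
    (hv : ∀ a ∈ l, p a ≠ p v) : ∃ l' ∈ insertions v l, l'.Pairwise (p · < p ·) ∧
      ∀ a, a ∈ l' ↔ a = v ∨ a ∈ l := by
  induction l with
  | nil => exact ⟨[v], by simp [insertions]⟩
  | cons a l ih =>
    rw [List.pairwise_cons] at hl
    rcases (hv a List.mem_cons_self).lt_or_gt with h | h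
    · obtain ⟨l', h1, h2, h3⟩ := ih hl.2 fun b hb => hv b (List.mem_cons_of_mem _ hb)
      refine ⟨a :: l', by simp [insertions, h1], ?_, fun b => by simp [h3]; tauto⟩
      rw [List.pairwise_cons]
      refine ⟨fun b hb => ?_, h2⟩
      rcases (h3 b).1 hb with rfl | hb
      exacts [h, hl.1 b hb]
    · refine ⟨v :: a :: l, by simp [insertions], ?_, by simp⟩
      refine List.pairwise_cons.2 ⟨fun b hb => ?_, List.pairwise_cons.2 hl⟩
      rcases List.mem_cons.1 hb with rfl | hb
      exacts [h, h.trans (hl.1 b hb)]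

/-- If `p` has no shortcut on `S`, the search fails along the branch that inserts each new code at
its place in the order of `p`. A search returning `true` therefore excludes every such `p`. -/
theorem not_allShortcut
    (hp : ∀ a ∈ S, ∀ b ∈ S, ∀ c ∈ S, ∀ d ∈ S, p a < p b → p b < p c → p c < p d → codeAdj a b →
      codeAdj b c → codeAdj c d → codeAdj a d → codeAdj a c ∧ codeAdj b d)
    (hinj : S.InjOn p) (vs l : List ℕ) (hS : ∀ a ∈ l, a ∈ S) (hvS : ∀ a ∈ vs, a ∈ S)
    (hnd : (vs ++ l).Nodup) (hl : l.Pairwise (p · < p ·)) : allShortcut l vs = false := by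
  induction vs generalizing l with
  | nil => exact not_hasShortcut hp l hS hl
  | cons v vs ih =>
    simp only [List.mem_cons, forall_eq_or_imp] at hvS
    rw [List.cons_append, List.nodup_cons] at hnd
    simp only [allShortcut, not_hasShortcut hp l hS hl, Bool.false_or]
    obtain ⟨l', h1, h2, h3⟩ := exists_insertion v l hl fun a ha h => by
      rw [hinj (hS a ha) hvS.1 h] at ha
      simp [ha] at hnd
    rw [List.all_eq_false]
    refine ⟨l', h1, ?_⟩
    rw [ih l' ?_ hvS.2 ?_ h2]
    · simp
    · intro a ha
      rcases (h3 a).1 ha with rfl | h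
      exacts [hvS.1, hS a h]
    · have := hnd.2
      rw [List.nodup_append] at this ⊢
      refine ⟨this.1, h2.imp fun h he => by simp [he] at h, fun a ha b hb => ?_⟩
      rcases (h3 b).1 hb with rfl | h
      · rintro rfl
        simp [ha] at hnd
      · exact this.2.2 a ha b h

end Search

/-- The codes of the vertices of `B i`, in an order for which the search is short. -/
def insertionOrder : Fin 7 → List ℕ :=
  ![ [10, 1, 9, 2, 0, 3, 7],
    [9, 3, 13, 2, 0, 7, 1],
    [0, 15, 4, 11, 1, 5, 2, 3],
    [2, 1, 0, 7, 3, 9, 11, 5],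
    [11, 3, 0, 15, 2, 5, 1, 7],
    [0, 1, 3, 6, 11, 15, 2, 8],
    [16, 7, 9, 0, 2, 3, 14, 4, 1] ]

theorem not_wordRepresentable_B (i : Fin 7) : ¬ WordRepresentable (B i) := by
  intro h
  obtain ⟨p, hinj, hp⟩ := h.exists_order
  have hinv : ∀ x, Function.invFun (code i) (code i x) = x :=
    Function.leftInverse_invFun (code_injective i)
  have hfalse := not_allShortcut (p := fun c => p (Function.invFun (code i) c))
    (S := Set.range (code i)) (by
      rintro _ ⟨a, rfl⟩ _ ⟨b, rfl⟩ _ ⟨c, rfl⟩ _ ⟨d, rfl⟩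
      simp only [hinv, codeAdj_code]
      exact hp a b c d)
    (by
      rintro _ ⟨a, rfl⟩ _ ⟨b, rfl⟩ h
      simp only [hinv] at h
      rw [hinj h])
    (insertionOrder i) [] (by simp)
    (by
      have : ∀ i : Fin 7, ∀ c ∈ insertionOrder i, ∃ x, code i x = c := by decide +kernel
      exact this i)
    (by
      have : ∀ i : Fin 7, (insertionOrder i ++ []).Nodup := by decide +kernel
      exact this i)
    List.Pairwise.nil
  have htrue : ∀ i : Fin 7, allShortcut [] (insertionOrder i) = true := by decide +kernel
  rw [htrue i] at hfalse
  cases hfalse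

/-! ### Minimality -/

/-- Whether `w` represents the graph with adjacency `codeAdj` on the codes in `l`. -/
def represents (l w : List ℕ) : Bool :=
  l.all fun c => w.contains c && l.all fun d =>
    c == d || codeAdj c d == decide ((w.filter (fun z => z = c ∨ z = d)).IsChain (· ≠ ·))

theorem wordRepresentable_of_represents {V : Type u} [Finite V] {G : SimpleGraph V}
    {l w : List ℕ} (h : represents l w = true) (φ : V → ℕ) (hφ : ∀ v, φ v ∈ l)
    (h_same : ∀ x y, x ≠ y → φ x = φ y → G.Adj x y)
    (h_ne : ∀ x y, φ x ≠ φ y → (G.Adj x y ↔ codeAdj (φ x) (φ y) = true)) :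
    WordRepresentable G := by
  simp only [represents, List.all_eq_true, Bool.and_eq_true, List.contains_iff_mem,
    Bool.or_eq_true, beq_iff_eq] at h
  refine wordRepresentable_of_map w φ (fun v => (h _ (hφ v)).1) h_same fun x y hxy => ?_
  rw [h_ne x y hxy, alternate_iff, ((h _ (hφ x)).2 _ (hφ y)).resolve_left hxy]
  exact decide_eq_true_iff

/-- For each vertex of `B i`, a word in codes that represents `B i` without that vertex. -/
def deletionWords : Fin 7 → List (List ℕ) :=
  ![[[1, 2, 3, 7, 10, 1, 9, 7, 2, 10, 9, 3],
     [0, 2, 3, 7, 9, 0, 10, 7, 2, 9, 10, 3],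
     [0, 1, 3, 9, 7, 0, 10, 9, 1, 7, 10, 3],
     [0, 1, 9, 2, 7, 0, 10, 9, 1, 7, 2, 10],
     [0, 3, 10, 1, 9, 2, 10, 0, 9, 3, 1, 2],
     [0, 1, 2, 3, 7, 0, 10, 1, 7, 2, 10, 3],
     [0, 1, 3, 9, 2, 7, 0, 9, 1, 7, 3, 2]],
    [[1, 2, 3, 7, 1, 9, 2, 13, 3, 7, 1, 9, 13, 7, 2, 9, 3, 13],
     [0, 2, 13, 3, 7, 9, 0, 13, 7, 2, 9, 3],
     [0, 1, 13, 3, 9, 7, 0, 13, 9, 1, 7, 3],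
     [0, 1, 9, 2, 13, 7, 0, 9, 13, 1, 7, 2],
     [0, 9, 3, 13, 1, 2, 0, 3, 1, 9, 2, 13],
     [0, 1, 2, 13, 3, 7, 0, 13, 1, 7, 2, 3],
     [0, 1, 3, 9, 2, 7, 0, 9, 1, 7, 3, 2]],
    [[1, 15, 2, 3, 11, 1, 2, 4, 5, 15, 11, 4, 5, 3],
     [0, 2, 15, 3, 5, 11, 0, 2, 4, 15, 3, 5, 11, 0, 4, 15, 5, 2, 11, 4, 3],
     [0, 4, 15, 11, 5, 4, 3, 1, 0, 15, 3, 11, 1, 5],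
     [0, 4, 11, 15, 5, 4, 2, 1, 0, 11, 2, 15, 1, 5],
     [0, 3, 11, 1, 2, 5, 15, 0, 11, 5, 3, 1, 15, 2],
     [0, 1, 15, 2, 3, 11, 0, 1, 2, 4, 15, 11, 4, 3],
     [0, 4, 15, 5, 4, 2, 3, 1, 0, 2, 15, 3, 1, 5],
     [0, 4, 11, 5, 4, 3, 2, 1, 0, 3, 11, 2, 1, 5]],
    [[1, 2, 3, 7, 11, 1, 9, 2, 3, 5, 7, 11, 1, 9, 5, 7, 2, 11, 9, 3, 5],
     [0, 2, 3, 7, 5, 9, 11, 0, 7, 5, 2, 9, 11, 3],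
     [0, 1, 3, 5, 9, 7, 11, 0, 5, 9, 1, 7, 11, 3],
     [0, 1, 9, 2, 5, 7, 11, 0, 9, 5, 1, 7, 2, 11],
     [0, 5, 2, 9, 1, 11, 3, 0, 2, 1, 3, 5, 9, 11],
     [0, 1, 3, 9, 11, 2, 7, 0, 9, 1, 11, 7, 3, 2],
     [0, 1, 2, 3, 5, 7, 11, 0, 5, 1, 7, 2, 11, 3],
     [0, 1, 3, 9, 2, 5, 7, 0, 9, 5, 1, 7, 3, 2]],
    [[1, 2, 15, 3, 7, 11, 1, 2, 5, 15, 3, 7, 11, 1, 5, 15, 7, 2, 11, 5, 3],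
     [0, 2, 15, 3, 7, 5, 11, 0, 15, 7, 5, 2, 11, 3],
     [0, 1, 3, 5, 7, 11, 15, 0, 5, 1, 7, 11, 3, 15],
     [0, 1, 2, 5, 7, 15, 11, 0, 5, 1, 7, 15, 2, 11],
     [0, 3, 11, 1, 2, 5, 15, 0, 11, 5, 3, 1, 15, 2],
     [0, 1, 2, 15, 3, 7, 11, 0, 1, 15, 7, 2, 11, 3],
     [0, 1, 3, 2, 5, 7, 15, 0, 5, 1, 7, 3, 15, 2],
     [0, 1, 2, 3, 5, 7, 11, 0, 5, 1, 7, 2, 11, 3]],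
    [[1, 2, 15, 3, 6, 11, 1, 8, 15, 6, 2, 11, 8, 3],
     [0, 15, 2, 3, 11, 0, 8, 2, 6, 15, 11, 8, 6, 3],
     [0, 1, 15, 3, 11, 0, 6, 1, 8, 15, 11, 6, 8, 3],
     [0, 1, 11, 2, 15, 0, 6, 1, 8, 11, 15, 6, 2, 8],
     [0, 1, 2, 15, 3, 0, 6, 1, 8, 15, 6, 2, 8, 3],
     [0, 1, 11, 6, 3, 2, 0, 1, 3, 8, 11, 2, 0, 6, 1, 8, 11, 3, 2, 6, 8],
     [0, 1, 2, 15, 3, 11, 0, 1, 8, 15, 2, 11, 8, 3],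
     [0, 11, 3, 1, 2, 15, 0, 3, 6, 11, 1, 15, 6, 2]],
    [[1, 2, 14, 3, 7, 1, 4, 9, 16, 14, 7, 4, 2, 9, 3, 16],
     [0, 7, 2, 9, 3, 0, 16, 2, 14, 3, 4, 7, 9, 16, 14, 4],
     [0, 9, 1, 7, 3, 0, 14, 1, 16, 3, 4, 9, 7, 14, 16, 4],
     [0, 9, 1, 2, 7, 0, 14, 1, 4, 16, 9, 7, 14, 4, 2, 16],
     [0, 1, 3, 9, 2, 7, 0, 14, 1, 16, 3, 9, 2, 7, 0, 14, 16, 9, 1, 7, 3, 14, 2, 16],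
     [0, 1, 3, 9, 2, 0, 4, 14, 1, 16, 3, 9, 2, 0, 4, 14, 16, 9, 4, 1, 3, 14, 2, 16],
     [0, 1, 3, 2, 7, 0, 14, 1, 16, 3, 2, 4, 7, 0, 14, 1, 16, 4, 7, 3, 14, 2, 16, 4],
     [0, 16, 2, 3, 4, 7, 9, 16, 4, 1, 0, 7, 2, 9, 3, 16, 4, 1, 0, 7, 2, 3, 1, 9],
     [0, 1, 3, 9, 2, 7, 0, 14, 1, 3, 4, 9, 2, 7, 0, 14, 4, 9, 1, 7, 3, 14, 4, 2]]]

theorem exists_deletion_word (i : Fin 7) (v : Fin 4 ⊕ Fin (forbiddenNbhds i).length) :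
    ∃ w, represents ((vertexCodes i).erase (code i v)) w = true := by
  have key : ∀ i : Fin 7, ∀ v : Fin 4 ⊕ Fin (forbiddenNbhds i).length,
      ∃ w ∈ deletionWords i, represents ((vertexCodes i).erase (code i v)) w = true := by
    decide +kernel
  obtain ⟨w, -, h⟩ := key i v
  exact ⟨w, h⟩

theorem minimalNonWordRepresentable_B (i : Fin 7) : MinimalNonWordRepresentable (B i) := by
  refine ⟨not_wordRepresentable_B i, fun s hs => ?_⟩
  -- A word for `B i` without one missing vertex `v` serves every induced subgraph avoiding `v`.
  obtain ⟨v, hv⟩ := (Set.ne_univ_iff_exists_notMem s).1 hs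
  obtain ⟨w, hw⟩ := exists_deletion_word i v
  refine wordRepresentable_of_represents hw (fun x : s => code i x) (fun x => ?_)
    (fun x y hxy he => absurd (Subtype.ext (code_injective i he)) hxy)
    fun x y hxy => (codeAdj_code i x y).symm
  have hne : code i x ≠ code i v := fun h => hv (code_injective i h ▸ x.2)
  rw [List.mem_erase_of_ne hne]
  have key : ∀ i : Fin 7, ∀ x, code i x ∈ vertexCodes i := by decide +kernel
  exact key i x

/-! ### Pairwise non-isomorphism and membership in the class -/

/-- The sum of the cubes of the degrees of `B i`. -/
def cubeSum (i : Fin 7) : ℕ :=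
  ∑ x, (B i).degree x ^ 3

/-- Smaller powers would not do: `B 0` and `B 1` agree in the sum of the degrees (30) and of their
squares (132). -/
theorem eq_of_iso {i j : Fin 7} (e : B i ≃g B j) : i = j := by
  have h : cubeSum i = cubeSum j :=
    Fintype.sum_equiv e.toEquiv _ _ fun x => by rw [← e.degree_eq x]; rfl
  have key : ∀ i j : Fin 7, cubeSum i = cubeSum j → i = j := by decide +kernel
  exact key i j h

theorem isKK_B (i : Fin 7) : ∃ n : ℕ, 1 ≤ n ∧ IsKK 4 n (B i) := by
  refine ⟨(forbiddenNbhds i).length, ?_, Finset.univ.map Function.Embedding.inl,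
    Finset.univ.map Function.Embedding.inr, ?_, ?_, ?_, ?_, ?_⟩
  · revert i; decide
  · simp [Finset.disjoint_left]
  · rintro (v | v) <;> simp
  · rw [SimpleGraph.isNClique_iff]
    refine ⟨?_, by simp⟩
    intro x hx y hy hxy
    simp only [Finset.coe_map, Finset.coe_univ, Set.image_univ, Set.mem_range] at hx hy
    obtain ⟨x, rfl⟩ := hx
    obtain ⟨y, rfl⟩ := hy
    exact fun h => hxy (congrArg _ h)
  · rw [SimpleGraph.isNClique_iff]
    refine ⟨?_, by simp⟩
    intro x hx y hy hxy
    simp only [Finset.coe_map, Finset.coe_univ, Set.image_univ, Set.mem_range] at hx hy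
    obtain ⟨x, rfl⟩ := hx
    obtain ⟨y, rfl⟩ := hy
    exact fun h => hxy (congrArg _ h)
  · have key : ∀ i : Fin 7, ∀ k, ∃ a, ¬ (B i).Adj (Sum.inr k) (Sum.inl a) := by decide +kernel
    intro v hv
    obtain ⟨k, -, rfl⟩ := Finset.mem_map.1 hv
    obtain ⟨a, ha⟩ := key i k
    exact ⟨Sum.inl a, by simp, ha⟩

/-! ### Families of neighbourhoods -/

/-- The neighbourhood `t` after relabelling the clique of size four by `σ`. -/
def relabel (σ : Fin 4 → Fin 4) (t : ℕ) : ℕ :=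
  ((List.finRange 4).map fun i => if t.testBit (σ i) then 2 ^ (i : ℕ) else 0).sum

def relabellings : List (Fin 4 → Fin 4) :=
  (List.finRange 4).flatMap fun a => (List.finRange 4).flatMap fun b =>
    (List.finRange 4).flatMap fun c => (List.finRange 4).flatMap fun d =>
      if [a, b, c, d].Nodup then [![a, b, c, d]] else []

/-- The minimal families of neighbourhoods that force some `B i`; each comes with the index `i` and
the codes of the vertices of an induced copy of `B i`. -/
def forcingFamilies : List (List ℕ × Fin 7 × List ℕ) :=
  [
    ([3, 5, 6], 0, [0, 1, 2, 3, 7, 9, 10]),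
    ([3, 5, 9], 1, [0, 1, 2, 3, 7, 9, 13]),
    ([1, 2, 3, 7], 2, [11, 7, 5, 6, 3, 2, 0, 1]),
    ([1, 2, 4, 7], 1, [11, 0, 1, 2, 5, 6, 8]),
    ([1, 3, 5, 7], 3, [0, 1, 2, 3, 7, 5, 9, 11]),
    ([2, 3, 7, 9], 5, [7, 11, 13, 6, 0, 1, 2, 3]),
    ([2, 4, 7, 9], 1, [11, 0, 1, 2, 13, 6, 8]),
    ([0, 7, 9, 10], 0, [11, 13, 14, 4, 0, 1, 3]),
    ([4, 7, 9, 10], 0, [11, 13, 14, 8, 0, 1, 3]),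
    ([0, 1, 7, 11], 2, [0, 1, 2, 3, 4, 5, 11, 15]),
    ([1, 3, 7, 11], 4, [0, 1, 2, 3, 7, 5, 11, 15]),
    ([1, 4, 7, 11], 5, [1, 0, 2, 3, 11, 15, 5, 8]),
    ([0, 7, 11, 12], 0, [11, 15, 16, 4, 0, 2, 3]),
    ([1, 7, 11, 12], 0, [11, 15, 16, 5, 1, 2, 3]),
    ([0, 7, 11, 13], 0, [11, 15, 17, 4, 1, 2, 3]),
    ([1, 7, 11, 13], 0, [11, 15, 17, 5, 1, 2, 3]),
    ([0, 5, 6, 9, 10], 6, [0, 2, 3, 1, 4, 9, 13, 10, 14]),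
    ([0, 5, 7, 9, 11], 4, [11, 0, 1, 2, 13, 4, 15, 9])]

/-- The maximal families of neighbourhoods of word-representable graphs, each with a word. -/
def representableFamilies : List (List ℕ × List ℕ) :=
  [
    ([0, 1, 2, 3, 4, 6, 8, 9],
      [0, 1, 2, 13, 3, 5, 7, 0, 6, 10, 1, 8, 2, 4, 12, 13, 3, 5, 7, 0, 6, 10, 8, 4, 12,
        13, 5, 1, 7, 6, 2, 10, 8, 4, 3, 12]),
    ([0, 1, 3, 4, 6, 7, 8, 9],
      [0, 1, 2, 13, 3, 5, 7, 11, 0, 10, 1, 8, 2, 4, 12, 13, 3, 5, 7, 11, 0, 10, 8, 4, 12,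
        13, 5, 1, 7, 2, 11, 10, 8, 4, 3, 12]),
    ([1, 2, 4, 5, 6, 8, 9, 10],
      [0, 3, 1, 9, 2, 5, 13, 0, 12, 14, 3, 6, 10, 1, 8, 9, 2, 5, 13, 0, 12, 14, 6, 10, 8,
        9, 5, 3, 13, 12, 1, 14, 6, 2, 10, 8]),
    ([1, 2, 5, 6, 7, 8, 9, 10],
      [0, 3, 11, 1, 9, 2, 5, 13, 0, 12, 14, 3, 6, 10, 11, 1, 9, 2, 5, 13, 0, 12, 14, 6,
        10, 11, 9, 5, 3, 13, 12, 1, 14, 6, 2, 10]),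
    ([0, 3, 4, 6, 7, 8, 9, 11],
      [0, 1, 2, 13, 15, 3, 7, 11, 0, 10, 1, 8, 2, 4, 12, 13, 15, 3, 7, 11, 0, 10, 8, 4,
        12, 13, 1, 15, 7, 2, 11, 10, 8, 4, 3, 12]),
    ([1, 2, 5, 6, 7, 9, 10, 11],
      [0, 14, 3, 6, 10, 11, 1, 9, 5, 13, 15, 14, 6, 2, 10, 0, 11, 9, 3, 1, 2, 5, 13, 15,
        0, 14, 6, 10, 11, 9, 5, 3, 13, 1, 15, 2]),
    ([3, 4, 6, 7, 8, 9, 11, 12],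
      [0, 1, 2, 13, 15, 3, 7, 11, 0, 10, 1, 8, 16, 2, 12, 13, 15, 3, 7, 11, 0, 10, 8, 16,
        12, 13, 1, 15, 7, 2, 11, 10, 8, 3, 16, 12]),
    ([2, 5, 6, 7, 9, 10, 11, 13],
      [0, 10, 2, 6, 14, 15, 13, 17, 9, 1, 11, 10, 6, 3, 14, 0, 15, 13, 2, 1, 17, 3, 9, 11,
        0, 10, 6, 14, 2, 15, 1, 13, 17, 9, 11, 3]),
    ([5, 6, 7, 9, 10, 11, 13, 14],
      [0, 2, 14, 15, 13, 17, 9, 1, 11, 10, 3, 18, 14, 0, 15, 13, 2, 1, 17, 3, 9, 11, 0,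
        10, 18, 14, 2, 15, 1, 13, 17, 9, 11, 10, 3, 18])]

/-! ### The dichotomy for sets of neighbourhoods -/

/-- The neighbourhoods that are in the family `l` after relabelling, as binary digits. -/
def familyMask (σ : Fin 4 → Fin 4) (l : List ℕ) : ℕ :=
  ((List.range 15).filter fun t => l.contains (relabel σ t)).foldr (fun t m => 2 ^ t ||| m) 0

theorem testBit_familyMask (σ : Fin 4 → Fin 4) (l : List ℕ) (t : ℕ) :
    (familyMask σ l).testBit t = true ↔ t < 15 ∧ relabel σ t ∈ l := by
  have key : ∀ l : List ℕ, (l.foldr (fun t m => 2 ^ t ||| m) 0).testBit t = true ↔ t ∈ l := by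
    intro l
    induction l with
    | nil => simp
    | cons a l ih =>
      rw [List.foldr_cons, Nat.testBit_or, Bool.or_eq_true, Nat.testBit_two_pow,
        decide_eq_true_iff, ih, List.mem_cons, eq_comm]
  rw [familyMask, key, List.mem_filter, List.mem_range, List.contains_iff_mem]

/-- The value `f n`; the kernel evaluates `n` first. -/
def force {α : Type*} (n : ℕ) (f : ℕ → α) : α :=
  Nat.rec (f 0) (fun m _ => f m.succ) n

theorem force_eq {α : Type*} (n : ℕ) (f : ℕ → α) : force n f = f n := by
  cases n <;> rfl

/-- The masks of the relabellings of the families in `F`. -/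
def masks (F : List (List ℕ)) : List ℕ :=
  relabellings.flatMap fun σ => F.map fun l => familyMask σ l

def anySubmask (I : ℕ) : List ℕ → Bool
  | [] => false
  | q :: l => (Nat.beq (Nat.land q I) q).or (anySubmask I l)

def anyCover (E : ℕ) : List ℕ → Bool
  | [] => false
  | m :: l => (Nat.beq (Nat.lor m E) 32767).or (anyCover E l)

/-- Whether each family of neighbourhoods that contains those in `I` and none of those in `E`
contains a member of a list `P` or is contained in a member of a list `Q`, by deciding one
neighbourhood for each entry `(b, P, Q)`, where `b` is its mask. -/
def dichotomy : List (ℕ × List ℕ × List ℕ) → ℕ → ℕ → Bool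
  | [], _, _ => false
  | (b, P, Q) :: L, I, E =>
    (force (Nat.lor I b) fun I' => (anySubmask I' P).or (dichotomy L I' E)).and
      (force (Nat.lor E b) fun E' => (anyCover E' Q).or (dichotomy L I E'))

theorem exists_of_anySubmask {I : ℕ} {P : List ℕ} (h : anySubmask I P = true) :
    ∃ q ∈ P, ∀ t, q.testBit t = true → I.testBit t = true := by
  induction P with
  | nil => cases h
  | cons q P ih =>
    rw [anySubmask, Bool.or_eq_true] at h
    rcases h with h | h
    · replace h := Nat.eq_of_beq_eq_true h
      refine ⟨q, List.mem_cons_self, fun t ht => ?_⟩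
      rw [← h] at ht
      exact (Bool.and_eq_true_iff.1 ((Nat.testBit_and q I t).symm.trans ht)).2
    · obtain ⟨q', hq', h⟩ := ih h
      exact ⟨q', List.mem_cons_of_mem _ hq', h⟩

theorem exists_of_anyCover {E : ℕ} {Q : List ℕ} (h : anyCover E Q = true) :
    ∃ m ∈ Q, ∀ t < 15, m.testBit t = true ∨ E.testBit t = true := by
  induction Q with
  | nil => cases h
  | cons m Q ih =>
    rw [anyCover, Bool.or_eq_true] at h
    rcases h with h | h
    · replace h := Nat.eq_of_beq_eq_true h
      refine ⟨m, List.mem_cons_self, fun t ht => ?_⟩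
      -- The mask 32767 is the set of all 15 neighbourhoods.
      have h1 : (2 ^ 15 - 1 : ℕ).testBit t = true := by
        rw [Nat.testBit_two_pow_sub_one]
        simpa using ht
      change (32767 : ℕ).testBit t = true at h1
      rw [← h] at h1
      exact Bool.or_eq_true_iff.1 ((Nat.testBit_or m E t).symm.trans h1)
    · obtain ⟨m', hm', h⟩ := ih h
      exact ⟨m', List.mem_cons_of_mem _ hm', h⟩

theorem exists_of_dichotomy (S : ℕ → Prop) {L : List (ℕ × List ℕ × List ℕ)}
    (hL : ∀ e ∈ L, ∃ k, e.1 = 2 ^ k) {I E : ℕ}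
    (hI : ∀ t, I.testBit t = true → S t) (hE : ∀ t, E.testBit t = true → ¬ S t)
    (h : dichotomy L I E = true) :
    (∃ e ∈ L, ∃ q ∈ e.2.1, ∀ t, q.testBit t = true → S t) ∨
      ∃ e ∈ L, ∃ m ∈ e.2.2, ∀ t < 15, S t → m.testBit t = true := by
  have testBit_lor : ∀ n k t : ℕ, (Nat.lor n (2 ^ k)).testBit t = true →
      n.testBit t = true ∨ k = t := by
    intro n k t ht
    simpa [Nat.testBit_two_pow] using (Nat.testBit_or n (2 ^ k) t).symm.trans ht
  induction L generalizing I E with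
  | nil => cases h
  | cons e L ih =>
    obtain ⟨b, P, Q⟩ := e
    obtain ⟨k, rfl⟩ : ∃ k, b = 2 ^ k := hL _ List.mem_cons_self
    replace ih := fun {I E : ℕ} => @ih (fun e he => hL e (List.mem_cons_of_mem _ he)) I E
    have lift : ∀ {p : ℕ × List ℕ × List ℕ → Prop}, (∃ e ∈ L, p e) →
        ∃ e ∈ (2 ^ k, P, Q) :: L, p e := by
      rintro p ⟨e, he, hp⟩
      exact ⟨e, List.mem_cons_of_mem _ he, hp⟩
    rw [dichotomy, Bool.and_eq_true, force_eq, force_eq, Bool.or_eq_true, Bool.or_eq_true] at h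
    by_cases hk : S k
    · have hI' : ∀ t, (Nat.lor I (2 ^ k)).testBit t = true → S t := by
        intro t ht
        rcases testBit_lor _ _ _ ht with ht | rfl
        exacts [hI t ht, hk]
      rcases h.1 with h | h
      · obtain ⟨q, hq, h⟩ := exists_of_anySubmask h
        exact Or.inl ⟨_, List.mem_cons_self, q, hq, fun t ht => hI' t (h t ht)⟩
      · exact (ih hI' hE h).imp lift lift
    · have hE' : ∀ t, (Nat.lor E (2 ^ k)).testBit t = true → ¬ S t := by
        intro t ht
        rcases testBit_lor _ _ _ ht with ht | rfl
        exacts [hE t ht, hk]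
      rcases h.2 with h | h
      · obtain ⟨m, hm, h⟩ := exists_of_anyCover h
        exact Or.inr ⟨_, List.mem_cons_self, m, hm, fun t ht hS =>
          (h t ht).resolve_right fun h => hE' t h hS⟩
      · exact (ih hI hE' h).imp lift lift

/-- The members of `P` and `Q` are checked as soon as their last neighbourhood is decided. -/
def table (P Q : List ℕ) : List (ℕ × List ℕ × List ℕ) :=
  (List.range 15).reverse.map fun k =>
    -- Neighbourhoods are decided from 14 down to 0, so the last one that matters is the lowest bit
    -- of `q`, or of the complement of `m`; the congruence says that this bit is `k`.
    (2 ^ k, P.filter (fun q => Nat.beq (Nat.mod q (Nat.pow 2 (k + 1))) (Nat.pow 2 k)),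
      Q.filter (fun m => Nat.beq (Nat.mod (Nat.sub 32767 m) (Nat.pow 2 (k + 1))) (Nat.pow 2 k)))

set_option maxHeartbeats 0 in
set_option maxRecDepth 100000 in
theorem dichotomy_table : dichotomy (table (masks (forcingFamilies.map Prod.fst))
    (masks (representableFamilies.map Prod.fst))) 0 0 = true := by
  decide +kernel

theorem exists_of_mem_masks {F : List (List ℕ)} {q : ℕ} (hq : q ∈ masks F) :
    ∃ σ ∈ relabellings, ∃ l ∈ F, ∀ t, q.testBit t = true ↔ t < 15 ∧ relabel σ t ∈ l := by
  simp only [masks, List.mem_flatMap, List.mem_map] at hq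
  obtain ⟨σ, hσ, l, hl, rfl⟩ := hq
  exact ⟨σ, hσ, l, hl, testBit_familyMask σ l⟩

/-- Each family of neighbourhoods contains a forcing one or is contained in a representable one, up
to relabelling. -/
theorem exists_family (S : ℕ → Prop) :
    (∃ σ ∈ relabellings, ∃ e ∈ forcingFamilies, ∀ t < 15, relabel σ t ∈ e.1 → S t) ∨
      ∃ σ ∈ relabellings, ∃ e ∈ representableFamilies, ∀ t < 15, S t → relabel σ t ∈ e.1 := by
  refine (exists_of_dichotomy S ?_ (by simp) (by simp) dichotomy_table).imp ?_ ?_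
  · intro e he
    obtain ⟨k, -, rfl⟩ := List.mem_map.1 he
    exact ⟨k, rfl⟩
  · rintro ⟨e, he, q, hq, h⟩
    obtain ⟨k, -, rfl⟩ := List.mem_map.1 he
    obtain ⟨σ, hσ, l, hl, hql⟩ := exists_of_mem_masks (List.mem_filter.1 hq).1
    obtain ⟨e, he, rfl⟩ := List.mem_map.1 hl
    exact ⟨σ, hσ, e, he, fun t ht hS => h t ((hql t).2 ⟨ht, hS⟩)⟩
  · rintro ⟨e, he, q, hq, h⟩
    obtain ⟨k, -, rfl⟩ := List.mem_map.1 he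
    obtain ⟨σ, hσ, l, hl, hql⟩ := exists_of_mem_masks (List.mem_filter.1 hq).1
    obtain ⟨e, he, rfl⟩ := List.mem_map.1 hl
    exact ⟨σ, hσ, e, he, fun t ht hS => ((hql t).1 (h t ht hS)).2⟩

/-! ### From labelled graphs to families -/

/-- The vertices of `G` are labelled by codes: `a i` has code `i`, and the other vertices form a
clique and have the codes `4 + t v`. -/
structure IsLabelling {V : Type u} (G : SimpleGraph V) (a : Fin 4 → V) (t : V → ℕ) : Prop where
  injective : a.Injective
  adj : ∀ i j, i ≠ j → G.Adj (a i) (a j)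
  clique : ∀ v w, v ∉ Set.range a → w ∉ Set.range a → v ≠ w → G.Adj v w
  testBit_iff : ∀ v, v ∉ Set.range a → ∀ i : Fin 4, (t v).testBit i = true ↔ G.Adj v (a i)

theorem testBit_relabel (σ : Fin 4 → Fin 4) (t : ℕ) (i : Fin 4) :
    (relabel σ t).testBit i = t.testBit (σ i) := by
  have key : ∀ b : Fin 4 → Bool, ∀ i : Fin 4,
      ((List.finRange 4).map fun i => if b i then 2 ^ (i : ℕ) else 0).sum.testBit i = b i := by
    decide +kernel
  exact key (fun i => t.testBit (σ i)) i

theorem bijective_of_mem_relabellings : ∀ σ ∈ relabellings, σ.Bijective := by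
  decide +kernel

variable {V : Type u} {G : SimpleGraph V} {a : Fin 4 → V} {t : V → ℕ}

theorem IsLabelling.relabel (h : IsLabelling G a t) {σ : Fin 4 → Fin 4} (hσ : σ.Bijective) :
    IsLabelling G (a ∘ σ) (fun v => relabel σ (t v)) where
  injective := h.injective.comp hσ.1
  adj i j hij := h.adj _ _ fun he => hij (hσ.1 he)
  clique := by
    rw [hσ.2.range_comp]
    exact h.clique
  testBit_iff := by
    rw [hσ.2.range_comp]
    intro v hv i
    rw [testBit_relabel, h.testBit_iff v hv]
    rfl

/-- The code of a vertex of a labelled graph. -/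
noncomputable def labelCode (a : Fin 4 → V) (t : V → ℕ) (v : V) : ℕ :=
  open scoped Classical in if h : ∃ i, a i = v then (h.choose : ℕ) else 4 + t v

theorem IsLabelling.labelCode_apply (h : IsLabelling G a t) (i : Fin 4) :
    labelCode a t (a i) = i := by
  have h' : ∃ j, a j = a i := ⟨i, rfl⟩
  rw [labelCode, dif_pos h', h.injective h'.choose_spec]

theorem labelCode_of_notMem {v : V} (hv : v ∉ Set.range a) : labelCode a t v = 4 + t v :=
  dif_neg hv

theorem IsLabelling.adj_iff (h : IsLabelling G a t) {v w : V}
    (hvw : labelCode a t v ≠ labelCode a t w) :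
    G.Adj v w ↔ codeAdj (labelCode a t v) (labelCode a t w) = true := by
  by_cases hv : v ∈ Set.range a <;> by_cases hw : w ∈ Set.range a
  · obtain ⟨i, rfl⟩ := hv
    obtain ⟨j, rfl⟩ := hw
    simp only [h.labelCode_apply] at hvw ⊢
    have hij : i ≠ j := fun he => hvw (congrArg _ he)
    simpa [codeAdj, h.adj i j hij] using hvw
  · obtain ⟨i, rfl⟩ := hv
    rw [h.labelCode_apply, labelCode_of_notMem hw, G.adj_comm, ← h.testBit_iff w hw i]
    simp [codeAdj]
  · obtain ⟨i, rfl⟩ := hw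
    rw [h.labelCode_apply, labelCode_of_notMem hv, ← h.testBit_iff v hv i]
    simp [codeAdj]
  · rw [labelCode_of_notMem hv, labelCode_of_notMem hw] at hvw ⊢
    have hne : v ≠ w := by rintro rfl; exact hvw rfl
    have : t v ≠ t w := fun he => hvw (by rw [he])
    simp [codeAdj, h.clique v w hv hw hne, this]

theorem IsLabelling.adj_of_labelCode_eq (h : IsLabelling G a t) {v w : V} (hne : v ≠ w)
    (hvw : labelCode a t v = labelCode a t w) : G.Adj v w := by
  by_cases hv : v ∈ Set.range a <;> by_cases hw : w ∈ Set.range a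
  · obtain ⟨i, rfl⟩ := hv
    obtain ⟨j, rfl⟩ := hw
    simp only [h.labelCode_apply] at hvw
    exact absurd (congrArg a (Fin.ext hvw)) hne
  · obtain ⟨i, rfl⟩ := hv
    rw [h.labelCode_apply, labelCode_of_notMem hw] at hvw
    omega
  · obtain ⟨i, rfl⟩ := hw
    rw [h.labelCode_apply, labelCode_of_notMem hv] at hvw
    omega
  · exact h.clique v w hv hw hne

theorem IsLabelling.wordRepresentable [Finite V] (h : IsLabelling G a t)
    {e : List ℕ × List ℕ} (he : e ∈ representableFamilies)
    (ht : ∀ v, v ∉ Set.range a → t v ∈ e.1) : WordRepresentable G := by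
  have key : ∀ e ∈ representableFamilies,
      represents ([0, 1, 2, 3] ++ e.1.map (4 + ·)) e.2 = true := by decide +kernel
  refine wordRepresentable_of_represents (key e he) (labelCode a t) (fun v => ?_)
    (fun v w => h.adj_of_labelCode_eq) fun v w => h.adj_iff
  rw [List.mem_append]
  by_cases hv : v ∈ Set.range a
  · obtain ⟨i, rfl⟩ := hv
    rw [h.labelCode_apply]
    left
    fin_cases i <;> simp
  · rw [labelCode_of_notMem hv]
    exact Or.inr (List.mem_map_of_mem (ht v hv))

/-- The embedding need not respect the two cliques: for some families the `K₄` of `B i` lies in the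
other clique of `G`, or consists of a vertex there and its three neighbours. -/
theorem IsLabelling.exists_isIndContained (h : IsLabelling G a t)
    {e : List ℕ × Fin 7 × List ℕ} (he : e ∈ forcingFamilies)
    (ht : ∀ s ∈ e.1, ∃ v, v ∉ Set.range a ∧ t v = s) : ∃ i, (B i).IsIndContained G := by
  have key : ∀ e ∈ forcingFamilies, ∀ x : Fin 4 ⊕ Fin (forbiddenNbhds e.2.1).length,
      (place e.2.2 x ∈ [0, 1, 2, 3] ++ e.1.map (4 + ·)) ∧
      ∀ y : Fin 4 ⊕ Fin (forbiddenNbhds e.2.1).length,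
        (place e.2.2 x = place e.2.2 y → x = y) ∧
        (codeAdj (place e.2.2 x) (place e.2.2 y) = true ↔ (B e.2.1).Adj x y) := by
    decide +kernel
  have hcode : ∀ c ∈ [0, 1, 2, 3] ++ e.1.map (4 + ·), ∃ v, labelCode a t v = c := by
    intro c hc
    rw [List.mem_append] at hc
    rcases hc with hc | hc
    · have : c < 4 := by
        simp only [List.mem_cons, List.not_mem_nil, or_false] at hc
        omega
      exact ⟨a ⟨c, this⟩, h.labelCode_apply _⟩
    · obtain ⟨s, hs, rfl⟩ := List.mem_map.1 hc
      obtain ⟨v, hv, rfl⟩ := ht s hs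
      exact ⟨v, labelCode_of_notMem hv⟩
  choose f hf using fun x => hcode _ (key e he x).1
  have hinj : f.Injective := fun x y hxy => ((key e he x).2 y).1 (by rw [← hf, ← hf, hxy])
  refine ⟨e.2.1, ⟨⟨⟨f, hinj⟩, fun {x y} => ?_⟩⟩⟩
  change G.Adj (f x) (f y) ↔ _
  by_cases hxy : x = y
  · subst hxy; simp
  · rw [h.adj_iff fun hc => hxy (((key e he x).2 y).1 (by rw [← hf, ← hf, hc])), hf, hf,
      ((key e he x).2 y).2]

theorem IsKK.finite {m n : ℕ} (h : IsKK m n G) : Finite V := by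
  classical
  obtain ⟨A, B, -, hcov, -⟩ := h
  refine Set.finite_univ_iff.1 ((A ∪ B).finite_toSet.subset fun v _ => ?_)
  simpa using hcov v

theorem IsKK.exists_isLabelling {n : ℕ} (h : IsKK 4 n G) :
    ∃ a t, IsLabelling G a t ∧ ∀ v, v ∉ Set.range a → t v < 15 := by
  classical
  obtain ⟨A, B, hdisj, hcov, hA, hB, hadj⟩ := h
  let e : Fin 4 ≃ A := (A.equivFinOfCardEq hA.card_eq).symm
  have hrange : ∀ v, v ∉ Set.range (fun i => (e i : V)) → v ∉ A := by
    rintro v hv hvA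
    exact hv ⟨e.symm ⟨v, hvA⟩, by simp⟩
  have hmem : ∀ v, v ∉ Set.range (fun i => (e i : V)) → v ∈ B := fun v hv =>
    (hcov v).resolve_left (hrange v hv)
  -- Only the full neighbourhood has number 15, and no vertex of the second clique has it.
  have key : ∀ b : Fin 4 → Bool, ∃ t < 16, ((∃ i, b i = false) → t < 15) ∧
      ∀ i : Fin 4, t.testBit i = b i := by decide +kernel
  choose t _ ht ht' using fun v : V => key fun i => decide (G.Adj v (e i))
  refine ⟨fun i => e i, t, ⟨?_, ?_, ?_, ?_⟩, ?_⟩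
  · exact Subtype.val_injective.comp e.injective
  · intro i j hij
    exact hA.isClique (e i).2 (e j).2 fun he => hij (e.injective (Subtype.ext he))
  · intro v w hv hw hvw
    exact hB.isClique (hmem v hv) (hmem w hw) hvw
  · intro v _ i
    rw [ht', decide_eq_true_iff]
  · intro v hv
    obtain ⟨x, hx, hvx⟩ := hadj v (hmem v hv)
    exact ht v ⟨e.symm ⟨x, hx⟩, by simpa using hvx⟩

theorem IsKK.wordRepresentable_or {n : ℕ} (h : IsKK 4 n G) :
    WordRepresentable G ∨ ∃ i, (B i).IsIndContained G := by
  have := h.finite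
  obtain ⟨a, t, hl, ht⟩ := h.exists_isLabelling
  rcases exists_family fun s => ∃ v, v ∉ Set.range a ∧ t v = s with
    ⟨σ, hσ, e, he, hS⟩ | ⟨σ, hσ, e, he, hS⟩
  · have hb := bijective_of_mem_relabellings σ hσ
    refine Or.inr ((hl.relabel hb).exists_isIndContained he fun s hs => ?_)
    -- The forcing family lists relabelled neighbourhoods, whereas `hS` speaks of the original ones.
    have key : ∀ σ ∈ relabellings, ∀ s < 15, ∃ s' < 15, TwoCliques.relabel σ s' = s := by
      decide +kernel
    have key' : ∀ e ∈ forcingFamilies, ∀ s ∈ e.1, s < 15 := by decide +kernel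
    obtain ⟨s', hs', rfl⟩ := key σ hσ s (key' e he s hs)
    obtain ⟨v, hv, rfl⟩ := hS s' hs' hs
    exact ⟨v, by rwa [hb.2.range_comp], rfl⟩
  · have hb := bijective_of_mem_relabellings σ hσ
    refine Or.inl ((hl.relabel hb).wordRepresentable he fun v hv => ?_)
    rw [hb.2.range_comp] at hv
    exact hS _ (ht v hv) ⟨v, hv, rfl⟩

theorem IsKK.wordRepresentable_iff {n : ℕ} (h : IsKK 4 n G) :
    WordRepresentable G ↔ ∀ i, ¬ (B i).IsIndContained G :=
  ⟨fun hG i hi => not_wordRepresentable_B i (hG.of_isIndContained hi),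
    fun hG => h.wordRepresentable_or.resolve_right fun ⟨i, hi⟩ => hG i hi⟩

theorem IsKK.exists_iso {n : ℕ} (h : IsKK 4 n G) (hG : MinimalNonWordRepresentable G) :
    ∃ i, Nonempty (G ≃g B i) := by
  obtain ⟨i, ⟨f⟩⟩ := h.wordRepresentable_or.resolve_left hG.1
  refine ⟨i, ⟨RelIso.symm (RelIso.ofSurjective f ?_)⟩⟩
  -- A range missing a vertex would induce a proper, hence representable, subgraph containing `B i`.
  rw [← Set.range_eq_univ]
  by_contra hne
  refine not_wordRepresentable_B i ((hG.2 _ hne).of_isIndContained ⟨?_⟩)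
  exact ⟨⟨fun x => ⟨f x, x, rfl⟩, fun x y hxy => f.injective (congrArg Subtype.val hxy)⟩,
    f.map_adj_iff⟩

end TwoCliques

theorem mainTheorem1 :
    -- the characterization by forbidden induced subgraphs
    (∀ (n : ℕ), 1 ≤ n → ∀ (V : Type u) (G : SimpleGraph V), TwoCliques.IsKK 4 n G →
      (TwoCliques.WordRepresentable G ↔
        ∀ i : Fin 7, ¬ (TwoCliques.B i).IsIndContained G)) ∧
    -- the seven graphs are pairwise non-isomorphic minimal non-word-representable graphs
    -- of the class
    (∀ i : Fin 7, (∃ n : ℕ, 1 ≤ n ∧ TwoCliques.IsKK 4 n (TwoCliques.B i)) ∧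
      TwoCliques.MinimalNonWordRepresentable (TwoCliques.B i)) ∧
    (∀ i j : Fin 7, Nonempty (TwoCliques.B i ≃g TwoCliques.B j) → i = j) ∧
    -- there are no others
    (∀ (n : ℕ), 1 ≤ n → ∀ (V : Type u) (G : SimpleGraph V), TwoCliques.IsKK 4 n G →
      TwoCliques.MinimalNonWordRepresentable G →
        ∃ i : Fin 7, Nonempty (G ≃g TwoCliques.B i)) :=
  ⟨fun _ _ _ _ h => h.wordRepresentable_iff,
    fun i => ⟨TwoCliques.isKK_B i, TwoCliques.minimalNonWordRepresentable_B i⟩,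
    fun _ _ ⟨e⟩ => TwoCliques.eq_of_iso e,
    fun _ _ _ _ h hG => h.exists_iso hG⟩
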